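/- Fix an integer $N\ge 2$ and index the rows and columns of $N\times N$ matrices by $0,\dots,N-1$. For integers $\ell\ge1$ and $0\le i,j\le N-1$ with $(i,j)\neq(0,0)$ let $\mathcal P^*_\ell(i,j)$ be the set of multisets $S$ of $\ell$ pairs from $\{0,\dots,N-1\}^2\setminus\{(0,0)\}$ whose sum is $(i,j)$, and let $c_S(m,n)$ be the multiplicity of $(m,n)$ in $S$. For a real matrix $A=(a_{ij})$ put \[ w_\ell(A)_{ij}:=\sum_{S\in\mathcal P^*_\ell(i,j)}\ \prod_{(m,n)\ne(0,0)}\frac{1}{c_S(m,n)!}\ \prod_{(p,q)\in S}a_{p,q}, \] where the last product is taken with multiplicity. For a real function $f$ and $h>0$ let $(D_h^\ell f)(x):=h^{-\ell}\sum_{j=0}^{\ell}\binom{\ell}{j}(-1)^{\ell-j}f(x+jh)$. Define the $N\times N$ matrices $f_\diamond(A)_h$ and (when the derivatives exist) $f_\diamond(A)$ by $(f_\diamond(A)_h)_{00}=(f_\diamond(A))_{00}=f(a_{00})$ and, for $(i,j)\ne(0,0)$, \[ (f_\diamond(A)_h)_{ij}=\sum_{\ell=1}^{i+j}(D_h^\ell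 f)(a_{00})\,w_\ell(A)_{ij},\qquad (f_\diamond(A))_{ij}=\sum_{\ell=1}^{i+j}f^{(\ell)}(a_{00})\,w_\ell(A)_{ij}. \] (a) Let $f:(0,\infty)\to\mathbb R$, and suppose that $f_\diamond(A)_h$ is positive semidefinite for every positive semidefinite $N\times N$ matrix $A$ with entries in $(0,\infty)$ and every $h>0$. If $N\ge3$, then $f\in C^{N-3}((0,\infty))$; for all $0\le k\le N-3$ the derivative $f^{(k)}$ is nonnegative and convex on $(0,\infty)$; and $f^{(N-3)}$ has a left-hand and a right-hand derivative at every point of $(0,\infty)$, both of which are nondecreasing functions on $(0,\infty)$. (For $N=2$ this part asserts nothing.) (b) Let $0<\rho\le\infty$, and let $f:(0,\rho)\to\mathbb R$ be $2N-2$ times differentiable. Suppose that $f_\diamond(A)$ is positive semidefinite for every positive semidefinite $N\times N$ matrix $A$ with entries in $(0,\rho)$. Then $f^{(k)}(x)\ge0$ for all $x\in(0,\rho)$ and all $0\le k\le N-1$. -/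

import Mathlib

open Set

namespace MatrixConvolution

/-- The nonzero index pairs of an `M × N` matrix: all `(p, q)` with `0 ≤ p < M`, `0 ≤ q < N`
and `(p, q) ≠ (0, 0)`. -/
def nonzeroIndices (M N : ℕ) : Finset (Fin M × Fin N) :=
  Finset.univ.filter fun s => ((s.1 : ℕ), (s.2 : ℕ)) ≠ (0, 0)

/-- The partitions of the pair `(i, j)` into `l` parts: all multisets of cardinality `l` of
nonzero index pairs whose sum, taken in `ℕ × ℕ`, is `(i, j)`. -/
def pairPartitions (M N l i j : ℕ) : Finset (Sym (Fin M × Fin N) l) :=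
  ((nonzeroIndices M N).sym l).filter fun S =>
    ((S : Multiset (Fin M × Fin N)).map fun s => ((s.1 : ℕ), (s.2 : ℕ))).sum = (i, j)

/-- The weight `∑_S (∏_{(m,n)} c_S(m,n)!)⁻¹ ∏_{(p,q) ∈ S} a_{p,q}`, where `S` runs over the
partitions of `(i, j)` into `l` parts, `c_S` is the multiplicity in `S`, and the last product
is taken with multiplicity. -/
noncomputable def partitionWeight {M N : ℕ} (A : Matrix (Fin M) (Fin N) ℝ) (l i j : ℕ) : ℝ :=
  ∑ S ∈ pairPartitions M N l i j,
    (1 / ∏ s ∈ nonzeroIndices M N,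
        (((S : Multiset (Fin M × Fin N)).count s).factorial : ℝ)) *
      ((S : Multiset (Fin M × Fin N)).map fun s => A s.1 s.2).prod

/-- The divided difference `(D_h^l f)(x) = h^{-l} (Δ_h^l f)(x)` of order `l` and step `h`. -/
noncomputable def dividedDiff (h : ℝ) (l : ℕ) (f : ℝ → ℝ) (x : ℝ) : ℝ :=
  1 / h ^ l * ((fwdDiff h)^[l] f) x

/-- The transform `f_⋄(A)_h`, built from the divided differences of `f` with step `h` at the
top left entry of `A`. -/
noncomputable def stepTransform (f : ℝ → ℝ) (h : ℝ) {M N : ℕ} (A : Matrix (Fin M) (Fin N) ℝ) :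
    Matrix (Fin M) (Fin N) ℝ :=
  Matrix.of fun i j =>
    if (i : ℕ) = 0 ∧ (j : ℕ) = 0 then f (A i j)
    else ∑ l ∈ Finset.Icc 1 ((i : ℕ) + (j : ℕ)),
      dividedDiff h l f (A ⟨0, i.pos⟩ ⟨0, j.pos⟩) * partitionWeight A l i j

/-- The transform `f_⋄(A)`, built from the derivatives of `f` at the top left entry of `A`. -/
noncomputable def derivTransform (f : ℝ → ℝ) {M N : ℕ} (A : Matrix (Fin M) (Fin N) ℝ) :
    Matrix (Fin M) (Fin N) ℝ :=
  Matrix.of fun i j =>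
    if (i : ℕ) = 0 ∧ (j : ℕ) = 0 then f (A i j)
    else ∑ l ∈ Finset.Icc 1 ((i : ℕ) + (j : ℕ)),
      iteratedDeriv l f (A ⟨0, i.pos⟩ ⟨0, j.pos⟩) * partitionWeight A l i j

/-- The interval `(0, ρ)` of real numbers, where `ρ` may be `∞`. -/
def openInterval (ρ : EReal) : Set ℝ := {x : ℝ | 0 < x ∧ (x : EReal) < ρ}

/-- `PSDMatrices N I` is the set of positive semidefinite `N × N` matrices with entries
in `I ⊆ ℝ`. -/
def PSDMatrices (N : ℕ) (I : Set ℝ) : Set (Matrix (Fin N) (Fin N) ℝ) :=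
  {A | A.PosSemidef ∧ ∀ i j, A i j ∈ I}

/-- `f` is `n` times differentiable on the open set `I`: the derivatives of order less than `n`
exist and are differentiable at every point of `I`. -/
def TimesDifferentiableOn (n : ℕ) (f : ℝ → ℝ) (I : Set ℝ) : Prop :=
  ∀ k < n, ∀ x ∈ I, DifferentiableAt ℝ (iteratedDeriv k f) x

end MatrixConvolution

namespace MatrixConvolution

open Filter Topology

/-! Only the diagonal entries of the transforms are needed. The matrices `testMatrix N a ε` have top
left entry `a`, and as `ε → 0` their only entry outside `(0, 0)` that stays nonzero is the one at
`(1, 1)`. The only partition of `(k, k)` surviving in the limit is then `k` copies of `(1, 1)`, so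
the `(k, k)` entry tends to a positive multiple of the `k`-th difference, or derivative, of `f` at
`a`. This is (b), and for (a) it yields nonnegative differences of all orders below `N`.

The rest of (a) is the Boas–Widder theorem, by induction on the order: `f` is convex, its right
derivative inherits the difference conditions with one order less, hence is itself convex and
continuous, which makes `f` differentiable. -/

/-! ### Convexity from first and second differences. -/

/-- The chord from the start of a convex sequence lies above the sequence. -/
lemma convexSeq_le_chord {u : ℕ → ℝ} (hu : ∀ i, 0 ≤ u (i + 2) - 2 * u (i + 1) + u i)
    {j m : ℕ} (hm : 0 < m) (hjm : j ≤ m) :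
    u j ≤ u 0 + (j / m : ℝ) * (u m - u 0) := by
  have key : ∀ i : ℕ, ((i : ℝ) + 1) * u i ≤ u 0 + i * u (i + 1) := by
    intro i
    induction i with
    | zero => simp
    | succ i ih =>
      have := mul_nonneg (by positivity : (0 : ℝ) ≤ i + 1) (hu i)
      push_cast
      linarith
  have mono : Monotone fun i : ℕ => (u (i + 1) - u 0) / ((i : ℝ) + 1) := by
    refine monotone_nat_of_le_succ fun i => ?_
    have := key (i + 1)
    push_cast at this ⊢
    rw [div_le_div_iff₀ (by positivity) (by positivity)]
    linarith
  rcases Nat.eq_zero_or_pos j with rfl | hj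
  · simp
  obtain ⟨j, rfl⟩ := Nat.exists_eq_add_of_le' hj
  obtain ⟨m, rfl⟩ := Nat.exists_eq_add_of_le' hm
  have h := mono (show j ≤ m by omega)
  simp only at h
  rw [div_le_iff₀ (by positivity)] at h
  push_cast
  have e : ((j : ℝ) + 1) / (m + 1) * (u (m + 1) - u 0)
      = (u (m + 1) - u 0) / ((m : ℝ) + 1) * (j + 1) := by ring
  linarith

/-- Nonnegative first and second differences on the positive half-line force convexity. -/
lemma convexOn_of_fwdDiff_nonneg {f : ℝ → ℝ}
    (h1 : ∀ x > 0, ∀ h > 0, 0 ≤ (fwdDiff h)^[1] f x)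
    (h2 : ∀ x > 0, ∀ h > 0, 0 ≤ (fwdDiff h)^[2] f x) : ConvexOn ℝ (Ioi 0) f := by
  refine LinearOrder.convexOn_of_lt (convex_Ioi 0) fun x hx y hy hxy a b ha hb hab => ?_
  rw [mem_Ioi] at hx hy
  have hmono : ∀ s t, 0 < s → s ≤ t → f s ≤ f t := by
    intro s t hs hst
    rcases hst.eq_or_lt with rfl | hst
    · rfl
    have := h1 s hs (t - s) (sub_pos.2 hst)
    simp only [Function.iterate_one, fwdDiff, add_sub_cancel] at this
    linarith
  -- No continuity of `f` is available, so `b` is rounded up to `j / m`. Monotonicity bounds `f` at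
  -- the intermediate point by its value at the `j`-th grid point, and the discrete chord bounds
  -- that; then `m → ∞`.
  have hlim : Tendsto (fun m : ℕ => f x + ((⌈b * (m : ℝ)⌉₊ : ℝ) / m) * (f y - f x)) atTop
      (𝓝 (f x + b * (f y - f x))) :=
    (((tendsto_nat_ceil_mul_div_atTop hb.le).comp tendsto_natCast_atTop_atTop).mul_const
      _).const_add _
  have e : a • f x + b • f y = f x + b * (f y - f x) := by
    simp only [smul_eq_mul]
    rw [← eq_sub_iff_add_eq] at hab
    rw [hab]; ring
  rw [e]
  refine ge_of_tendsto hlim ?_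
  filter_upwards [eventually_gt_atTop 0] with m hm
  have hm' : (0 : ℝ) < m := by exact_mod_cast hm
  set j := ⌈b * (m : ℝ)⌉₊ with hj
  have hjm : j ≤ m := by
    rw [hj, Nat.ceil_le]
    nlinarith
  have hbj : b ≤ (j : ℝ) / m := by
    rw [le_div_iff₀ hm']
    exact Nat.le_ceil _
  set d := (y - x) / m with hd
  have hd0 : 0 < d := div_pos (sub_pos.2 hxy) hm'
  have chord := convexSeq_le_chord (u := fun i : ℕ => f (x + i * d)) (fun i => by
    have := h2 (x + i * d) (by positivity) d hd0
    simp only [Function.iterate_succ, Function.iterate_zero, Function.comp, id, fwdDiff] at this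
    push_cast
    rw [show x + ((i : ℝ) + 2) * d = x + i * d + d + d by ring,
      show x + ((i : ℝ) + 1) * d = x + i * d + d by ring]
    linarith) hm hjm
  simp only [Nat.cast_zero, zero_mul, add_zero] at chord
  rw [show x + (m : ℝ) * d = y by rw [hd]; field_simp; ring] at chord
  refine (hmono _ _ ?_ ?_).trans chord
  · simp only [smul_eq_mul]; positivity
  · have : b * (y - x) ≤ (j : ℝ) * d := by
      rw [hd, mul_div_left_comm, mul_comm (y - x)]
      exact mul_le_mul_of_nonneg_right hbj (sub_pos.2 hxy).le
    simp only [smul_eq_mul]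
    rw [← eq_sub_iff_add_eq] at hab
    rw [hab]
    linarith

/-! ### The Boas–Widder theorem. -/

/-- Nonnegativity of differences passes from a step to its integer multiples. -/
lemma fwdDiff_iter_natMul_nonneg (t : ℝ) (ht : 0 < t) (m k : ℕ) {F : ℝ → ℝ}
    (hF : ∀ x > 0, 0 ≤ (fwdDiff t)^[k] F x) :
    ∀ x > 0, 0 ≤ (fwdDiff (m * t))^[k] F x := by
  induction k generalizing F with
  | zero => exact hF
  | succ k ih =>
    rw [Function.iterate_succ_apply]
    refine ih fun x hx => ?_
    -- A difference of step `m * t` telescopes into `m` shifted differences of step `t`.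
    have e : fwdDiff (m * t) F
        = ∑ i ∈ Finset.range m, fun y => fwdDiff t F (y + i * t) := by
      ext y
      have := Finset.sum_range_sub (fun i : ℕ => F (y + i * t)) m
      simp only [Nat.cast_zero, zero_mul, add_zero] at this
      rw [Finset.sum_apply, fwdDiff, ← this]
      refine Finset.sum_congr rfl fun i _ => ?_
      simp only [fwdDiff]
      push_cast
      ring_nf
    rw [e, fwdDiff_iter_finsetSum, Finset.sum_apply]
    refine Finset.sum_nonneg fun i _ => ?_
    rw [fwdDiff_iter_comp_add, ← Function.iterate_succ_apply]
    exact hF _ (by positivity)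

/-- The differences of a right derivative are nonnegative when those of the function, of one
order more, are. -/
lemma fwdDiff_iter_rightDeriv_nonneg {f g : ℝ → ℝ} {k : ℕ}
    (hg : ∀ x > 0, HasDerivWithinAt f (g x) (Ioi x) x)
    (hf : ∀ x > 0, ∀ h > 0, 0 ≤ (fwdDiff h)^[k + 1] f x) :
    ∀ x > 0, ∀ h > 0, 0 ≤ (fwdDiff h)^[k] g x := by
  intro x hx h hh
  -- The hypothesis only covers differences with equal steps. Steps `h / (m + 1)` divide `h` evenly,
  -- so they also control `k` differences of step `h` applied to one small difference.
  have ht : Tendsto (fun m : ℕ => h / ((m : ℝ) + 1)) atTop (𝓝[>] 0) := by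
    rw [tendsto_nhdsWithin_iff]
    refine ⟨?_, Eventually.of_forall fun m => ?_⟩
    · simpa [div_eq_mul_inv] using (tendsto_one_div_add_atTop_nhds_zero_nat (𝕜 := ℝ)).const_mul h
    · exact div_pos hh (by positivity)
  have hlim : Tendsto (fun m : ℕ => (fwdDiff h)^[k]
      (fun y => (h / ((m : ℝ) + 1))⁻¹ • fwdDiff (h / ((m : ℝ) + 1)) f y) x) atTop
      (𝓝 ((fwdDiff h)^[k] g x)) := by
    simp only [fwdDiff_iter_eq_sum_shift]
    refine tendsto_finsetSum _ fun i _ => Tendsto.const_smul ?_ _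
    have hp : 0 < x + i • h := by positivity
    have := (hasDerivWithinAt_iff_tendsto_slope' (lt_irrefl _)).1 (hg _ hp)
    have shift : Tendsto (fun m : ℕ => x + i • h + h / ((m : ℝ) + 1)) atTop
        (𝓝[>] (x + i • h)) := by
      rw [tendsto_nhdsWithin_iff] at ht ⊢
      refine ⟨by simpa using ht.1.const_add (x + i • h), ?_⟩
      filter_upwards [ht.2] with m hm
      exact lt_add_of_pos_right _ (mem_Ioi.1 hm)
    refine (this.comp shift).congr fun m => ?_
    simp [slope, fwdDiff]
  refine ge_of_tendsto' hlim fun m => ?_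
  have hm : 0 < h / ((m : ℝ) + 1) := div_pos hh (by positivity)
  have hnn := fwdDiff_iter_natMul_nonneg (h / ((m : ℝ) + 1)) hm (m + 1) k
    (F := fwdDiff (h / ((m : ℝ) + 1)) f)
    (fun y hy => by rw [← Function.iterate_succ_apply]; exact hf y hy _ hm) x hx
  rw [show ((m + 1 : ℕ) : ℝ) * (h / ((m : ℝ) + 1)) = h by push_cast; field_simp] at hnn
  have := fwdDiff_iter_const_smul h ((h / ((m : ℝ) + 1))⁻¹) (fwdDiff (h / ((m : ℝ) + 1)) f) k
  change 0 ≤ (fwdDiff h)^[k] ((h / ((m : ℝ) + 1))⁻¹ • fwdDiff (h / ((m : ℝ) + 1)) f) x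
  rw [this]
  exact mul_nonneg (inv_nonneg.2 hm.le) hnn

/-- A convex function on the positive half-line whose right derivative is continuous there is
differentiable. -/
lemma hasDerivAt_of_convexOn_of_continuousOn_rightDeriv {f g : ℝ → ℝ}
    (hf : ConvexOn ℝ (Ioi 0) f) (hg : ∀ x > 0, HasDerivWithinAt f (g x) (Ioi x) x)
    (hc : ContinuousOn g (Ioi 0)) {x : ℝ} (hx : 0 < x) : HasDerivAt f (g x) x := by
  have hxi : x ∈ interior (Ioi (0 : ℝ)) := by simpa using hx
  have hl := hf.hasDerivWithinAt_leftDeriv_of_mem_interior hxi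
  have hr := hg x hx
  have eq : derivWithin f (Iio x) x = g x := by
    apply le_antisymm
    · refine (hf.leftDeriv_le_rightDeriv_of_mem_interior hxi).trans_eq ?_
      exact hr.derivWithin (uniqueDiffWithinAt_Ioi x)
    -- For `y < x`, `g y` is at most the slope from `y` to `x`, which is at most the left derivative
    -- at `x`; let `y → x`.
    · have hlim : Tendsto g (𝓝[<] x) (𝓝 (g x)) :=
        ((hc x hx).continuousAt (Ioi_mem_nhds hx)).tendsto.mono_left nhdsWithin_le_nhds
      refine le_of_tendsto hlim ?_
      filter_upwards [self_mem_nhdsWithin, mem_nhdsWithin_of_mem_nhds (Ioi_mem_nhds hx)]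
        with y hy hy0
      exact (hf.le_slope_of_hasDerivWithinAt_Ioi hy0 hx hy (hg y hy0)).trans
        (hf.slope_le_of_hasDerivWithinAt_Iio hy0 hx hy hl)
  rw [eq] at hl
  have h := hl.union hr
  rwa [Iio_union_Ioi, compl_eq_univ_sdiff, hasDerivWithinAt_sdiff_singleton,
    hasDerivWithinAt_univ] at h

/-- **Boas–Widder.** Nonnegative differences of all orders up to `n + 2` give `n` continuous
derivatives, all of them nonnegative and convex. -/
theorem contDiffOn_and_convexOn_of_fwdDiff_nonneg (n : ℕ) {f : ℝ → ℝ}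
    (hf : ∀ k ≤ n + 2, ∀ x > 0, ∀ h > 0, 0 ≤ (fwdDiff h)^[k] f x) :
    ContDiffOn ℝ n f (Ioi 0) ∧
      ∀ k ≤ n, (∀ x > 0, 0 ≤ iteratedDeriv k f x) ∧ ConvexOn ℝ (Ioi 0) (iteratedDeriv k f) := by
  have hconv : ∀ {φ : ℝ → ℝ}, (∀ k ≤ 2, ∀ x > 0, ∀ h > 0, 0 ≤ (fwdDiff h)^[k] φ x) →
      ConvexOn ℝ (Ioi 0) φ := fun h =>
    convexOn_of_fwdDiff_nonneg (h 1 (by norm_num)) (h 2 le_rfl)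
  have hcont : ∀ {φ : ℝ → ℝ}, ConvexOn ℝ (Ioi 0) φ → ContinuousOn φ (Ioi 0) := fun h => by
    simpa using h.continuousOn_interior
  induction n generalizing f with
  | zero =>
    have hc := hconv hf
    refine ⟨by simpa using hcont hc, fun k hk => ?_⟩
    obtain rfl : k = 0 := by omega
    rw [iteratedDeriv_zero]
    exact ⟨fun x hx => hf 0 (by omega) x hx 1 one_pos, hc⟩
  | succ n ih =>
    have hc := hconv fun k hk => hf k (by omega)
    set g : ℝ → ℝ := fun x => derivWithin f (Ioi x) x
    have hg : ∀ x > 0, HasDerivWithinAt f (g x) (Ioi x) x := fun x hx =>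
      hc.hasDerivWithinAt_rightDeriv_of_mem_interior (by simpa using hx)
    have hgd : ∀ k ≤ n + 2, ∀ x > 0, ∀ h > 0, 0 ≤ (fwdDiff h)^[k] g x := fun k hk =>
      fwdDiff_iter_rightDeriv_nonneg hg (hf (k + 1) (by omega))
    -- Order at least two is left for `g`, so `g` is convex and therefore continuous.
    have hgc := hcont (hconv fun k hk => hgd k (by omega))
    have hder : ∀ x > 0, HasDerivAt f (g x) x := fun x hx =>
      hasDerivAt_of_convexOn_of_continuousOn_rightDeriv hc hg hgc hx
    have hd : ∀ k ≤ n + 2, ∀ x > 0, ∀ h > 0, 0 ≤ (fwdDiff h)^[k] (deriv f) x := by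
      intro k hk x hx h hh
      have := hgd k hk x hx h hh
      rw [fwdDiff_iter_eq_sum_shift] at this ⊢
      refine this.trans_eq (Finset.sum_congr rfl fun i _ => ?_)
      rw [(hder (x + i • h) (by positivity)).deriv]
    obtain ⟨hC, hD⟩ := ih hd
    refine ⟨?_, fun k hk => ?_⟩
    · rw [show ((n + 1 : ℕ) : WithTop ℕ∞) = (n : WithTop ℕ∞) + 1 by norm_cast,
        contDiffOn_succ_iff_deriv_of_isOpen isOpen_Ioi]
      exact ⟨fun x hx => (hder x hx).differentiableAt.differentiableWithinAt, by simp, hC⟩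
    · cases k with
      | zero =>
        rw [iteratedDeriv_zero]
        exact ⟨fun x hx => hf 0 (by omega) x hx 1 one_pos, hc⟩
      | succ k =>
        rw [iteratedDeriv_succ']
        exact hD k (by omega)

/-! ### Test matrices and their partition weights. -/

/-- The matrix `diag(a - ε, a / 2, 0, …, 0)` plus `ε` times the all-ones matrix. -/
noncomputable def testMatrix (N : ℕ) (a ε : ℝ) : Matrix (Fin N) (Fin N) ℝ :=
  Matrix.diagonal (fun i : Fin N => if (i : ℕ) = 0 then a - ε else if (i : ℕ) = 1 then a / 2 else 0) +
    ε • Matrix.vecMulVec (fun _ : Fin N => (1 : ℝ)) (star fun _ : Fin N => (1 : ℝ))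

lemma testMatrix_apply {N : ℕ} (a ε : ℝ) (i j : Fin N) :
    testMatrix N a ε i j =
      (if i = j then
        (if (i : ℕ) = 0 then a - ε else if (i : ℕ) = 1 then a / 2 else 0) else 0) + ε := by
  simp [testMatrix, Matrix.diagonal_apply, Matrix.vecMulVec_apply]

lemma testMatrix_posSemidef {N : ℕ} {a ε : ℝ} (hε : 0 ≤ ε) (hεa : ε ≤ a / 2) :
    (testMatrix N a ε).PosSemidef := by
  refine (Matrix.PosSemidef.diagonal fun i => ?_).add
    ((Matrix.posSemidef_vecMulVec_self_star _).smul hε)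
  simp only [Pi.zero_apply]
  split_ifs <;> linarith

/-- The bound by `a` keeps all entries in `(0, ρ)` once `a` lies there; the value `a / 2` in the
matrix leaves room for adding `ε`. -/
lemma testMatrix_mem {N : ℕ} {a ε : ℝ} (hε : 0 < ε) (hεa : ε ≤ a / 2) (i j : Fin N) :
    0 < testMatrix N a ε i j ∧ testMatrix N a ε i j ≤ a := by
  rw [testMatrix_apply]
  split_ifs <;> constructor <;> linarith

lemma continuous_partitionWeight_testMatrix (N : ℕ) (a : ℝ) (l i j : ℕ) :
    Continuous fun ε => partitionWeight (testMatrix N a ε) l i j := by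
  unfold partitionWeight
  refine continuous_finsetSum _ fun S _ => continuous_const.mul ?_
  refine continuous_multiset_prod _ fun s _ => ?_
  simp only [testMatrix_apply]
  split_ifs <;> fun_prop

/-- At `ε = 0` only the partitions with all parts equal to `(1, 1)` contribute. -/
lemma partitionWeight_testMatrix_zero_of_ne {N l k : ℕ} (a : ℝ) (hlk : l ≠ k) :
    partitionWeight (testMatrix N a 0) l k k = 0 := by
  refine Finset.sum_eq_zero fun S hS => mul_eq_zero_of_right _ ?_
  rw [pairPartitions, Finset.mem_filter, Finset.mem_sym_iff] at hS
  by_contra hne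
  rw [Multiset.prod_eq_zero_iff, Multiset.mem_map] at hne
  push Not at hne
  have h1 : ∀ s ∈ (S : Multiset (Fin N × Fin N)), ((s.1 : ℕ), (s.2 : ℕ)) = (1, 1) := by
    intro s hs
    have hs0 := (Finset.mem_filter.1 (hS.1 s hs)).2
    have := hne s hs
    rw [testMatrix_apply] at this
    by_cases he : s.1 = s.2
    · have he' : (s.1 : ℕ) = s.2 := congrArg _ he
      rw [if_pos he] at this
      split_ifs at this with h0 h1
      · exact absurd (Prod.ext h0 (he' ▸ h0)) hs0
      · exact Prod.ext h1 (he' ▸ h1)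
      · simp at this
    · simp [he] at this
  have := hS.2
  rw [Multiset.map_congr rfl h1] at this
  simp at this
  exact hlk this

/-- The partition into `k` copies of `(1, 1)` contributes `(a / 2) ^ k / k!`, and no term is
negative. -/
lemma partitionWeight_testMatrix_zero_pos {N k : ℕ} (hN : 2 ≤ N) {a : ℝ} (ha : 0 < a) :
    0 < partitionWeight (testMatrix N a 0) k k k := by
  have hnn : ∀ i j, 0 ≤ testMatrix N a 0 i j := by
    intro i j
    rw [testMatrix_apply]
    split_ifs <;> linarith
  let o : Fin N := ⟨1, hN⟩
  refine Finset.sum_pos' (fun S _ => mul_nonneg (by positivity) ?_)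
    ⟨Sym.replicate k (o, o), ?_, ?_⟩
  · refine Multiset.prod_nonneg fun x hx => ?_
    obtain ⟨s, -, rfl⟩ := Multiset.mem_map.1 hx
    exact hnn _ _
  · rw [pairPartitions, Finset.mem_filter, Finset.mem_sym_iff]
    refine ⟨fun s hs => ?_, by simp [Sym.coe_replicate, o]⟩
    rw [Sym.mem_replicate.1 hs |>.2]
    simp [nonzeroIndices, o]
  · refine mul_pos (by positivity) ?_
    simp only [Sym.coe_replicate, Multiset.map_replicate, Multiset.prod_replicate]
    refine pow_pos ?_ _
    rw [testMatrix_apply]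
    simp [o, ha]

/-- If the combination of the weights with coefficients `c` is nonnegative at all test matrices
then the coefficient of order `k` is nonnegative. -/
lemma coeff_nonneg_of_partitionWeight {N k : ℕ} (hN : 2 ≤ N) (hk : 1 ≤ k) {a : ℝ} (ha : 0 < a)
    {c : ℕ → ℝ}
    (h : ∀ ε, 0 < ε → ε ≤ a / 2 →
      0 ≤ ∑ l ∈ Finset.Icc 1 (k + k), c l * partitionWeight (testMatrix N a ε) l k k) :
    0 ≤ c k := by
  have hcont : Continuous fun ε =>
      ∑ l ∈ Finset.Icc 1 (k + k), c l * partitionWeight (testMatrix N a ε) l k k :=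
    continuous_finsetSum _ fun l _ =>
      continuous_const.mul (continuous_partitionWeight_testMatrix N a l k k)
  -- At `ε = 0` the matrix has zero entries and is not admissible, so the inequality there is
  -- obtained as a limit from the right.
  have h0 : 0 ≤ ∑ l ∈ Finset.Icc 1 (k + k), c l * partitionWeight (testMatrix N a 0) l k k := by
    refine ge_of_tendsto ((hcont.tendsto 0).mono_left (nhdsWithin_le_nhds (s := Ioi 0))) ?_
    filter_upwards [Ioc_mem_nhdsGT (half_pos ha)] with ε hε
    exact h ε hε.1 hε.2
  rw [Finset.sum_eq_single_of_mem k (Finset.mem_Icc.2 ⟨hk, by omega⟩) fun l _ hl => by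
    rw [partitionWeight_testMatrix_zero_of_ne a hl, mul_zero]] at h0
  exact nonneg_of_mul_nonneg_left h0 (partitionWeight_testMatrix_zero_pos hN ha)

lemma testMatrix_zero_zero {N : ℕ} (hN : 0 < N) (a ε : ℝ) :
    testMatrix N a ε ⟨0, hN⟩ ⟨0, hN⟩ = a := by
  simp [testMatrix_apply]

/-! ### Signs of differences and derivatives from diagonal entries. -/

theorem fwdDiff_nonneg_of_stepTransform {N : ℕ} (hN : 2 ≤ N) {f : ℝ → ℝ}
    (hf : ∀ A ∈ PSDMatrices N (Ioi 0), ∀ h : ℝ, 0 < h → (stepTransform f h A).PosSemidef)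
    {k : ℕ} (hk : k < N) {a h : ℝ} (ha : 0 < a) (hh : 0 < h) : 0 ≤ (fwdDiff h)^[k] f a := by
  have hpos : ∀ ε, 0 < ε → ε ≤ a / 2 → 0 ≤ stepTransform f h (testMatrix N a ε) ⟨k, hk⟩ ⟨k, hk⟩ :=
    fun ε hε hεa => (hf _ ⟨testMatrix_posSemidef hε.le hεa,
      fun i j => (testMatrix_mem hε hεa i j).1⟩ h hh).diag_nonneg
  rcases Nat.eq_zero_or_pos k with rfl | hk0
  · have := hpos (a / 2) (half_pos ha) le_rfl
    simpa [stepTransform, testMatrix_zero_zero] using this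
  · have := coeff_nonneg_of_partitionWeight hN hk0 ha (c := fun l => dividedDiff h l f a)
      fun ε hε hεa => by
        simpa [stepTransform, testMatrix_zero_zero, hk0.ne'] using hpos ε hε hεa
    rw [dividedDiff] at this
    exact nonneg_of_mul_nonneg_right this (by positivity)

theorem iteratedDeriv_nonneg_of_derivTransform {N : ℕ} (hN : 2 ≤ N) {ρ : EReal} {f : ℝ → ℝ}
    (hf : ∀ A ∈ PSDMatrices N (openInterval ρ), (derivTransform f A).PosSemidef)
    {k : ℕ} (hk : k < N) {a : ℝ} (ha : a ∈ openInterval ρ) : 0 ≤ iteratedDeriv k f a := by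
  obtain ⟨ha, haρ⟩ := ha
  have hpos : ∀ ε, 0 < ε → ε ≤ a / 2 → 0 ≤ derivTransform f (testMatrix N a ε) ⟨k, hk⟩ ⟨k, hk⟩ :=
    fun ε hε hεa => (hf _ ⟨testMatrix_posSemidef hε.le hεa,
      fun i j => ⟨(testMatrix_mem hε hεa i j).1,
        (EReal.coe_le_coe_iff.2 (testMatrix_mem hε hεa i j).2).trans_lt haρ⟩⟩).diag_nonneg
  rcases Nat.eq_zero_or_pos k with rfl | hk0
  · have := hpos (a / 2) (half_pos ha) le_rfl
    simpa [derivTransform, testMatrix_zero_zero] using this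
  · exact coeff_nonneg_of_partitionWeight hN hk0 ha (c := fun l => iteratedDeriv l f a)
      fun ε hε hεa => by
        simpa [derivTransform, testMatrix_zero_zero, hk0.ne'] using hpos ε hε hεa

end MatrixConvolution

theorem theoremT (N : ℕ) (hN : 2 ≤ N) :
    (∀ f : ℝ → ℝ,
      (∀ A ∈ MatrixConvolution.PSDMatrices N (Ioi 0), ∀ h : ℝ, 0 < h →
        (MatrixConvolution.stepTransform f h A).PosSemidef) →
      (3 ≤ N → ContDiffOn ℝ ((N - 3 : ℕ) : WithTop ℕ∞) f (Ioi 0)) ∧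
      (∀ k : ℕ, k + 3 ≤ N → ∀ x ∈ Ioi (0 : ℝ), 0 ≤ iteratedDeriv k f x) ∧
      (∀ k : ℕ, k + 3 ≤ N → ConvexOn ℝ (Ioi 0) (iteratedDeriv k f)) ∧
      (3 ≤ N →
        (∀ x ∈ Ioi (0 : ℝ), DifferentiableWithinAt ℝ (iteratedDeriv (N - 3) f) (Iio x) x) ∧
        (∀ x ∈ Ioi (0 : ℝ), DifferentiableWithinAt ℝ (iteratedDeriv (N - 3) f) (Ioi x) x) ∧
        MonotoneOn (fun x => derivWithin (iteratedDeriv (N - 3) f) (Iio x) x) (Ioi 0) ∧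
        MonotoneOn (fun x => derivWithin (iteratedDeriv (N - 3) f) (Ioi x) x) (Ioi 0))) ∧
    (∀ ρ : EReal, 0 < ρ → ∀ f : ℝ → ℝ,
      MatrixConvolution.TimesDifferentiableOn (2 * N - 2) f (MatrixConvolution.openInterval ρ) →
      (∀ A ∈ MatrixConvolution.PSDMatrices N (MatrixConvolution.openInterval ρ),
        (MatrixConvolution.derivTransform f A).PosSemidef) →
      ∀ k : ℕ, k ≤ N - 1 → ∀ x ∈ MatrixConvolution.openInterval ρ, 0 ≤ iteratedDeriv k f x) := by
  refine ⟨fun f hf => ?_, fun ρ _ f _ hf k hk x hx =>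
    MatrixConvolution.iteratedDeriv_nonneg_of_derivTransform hN hf (by omega) hx⟩
  -- With `n = N - 3`, the required orders up to `n + 2 = N - 1` are exactly those of the diagonal
  -- entries.
  have key : 3 ≤ N → _ := fun h3 =>
    MatrixConvolution.contDiffOn_and_convexOn_of_fwdDiff_nonneg (N - 3) (f := f)
      fun k hk x hx h hh =>
        MatrixConvolution.fwdDiff_nonneg_of_stepTransform hN hf (by omega) hx hh
  refine ⟨fun h3 => (key h3).1, fun k hk => ((key (by omega)).2 k (by omega)).1,
    fun k hk => ((key (by omega)).2 k (by omega)).2, fun h3 => ?_⟩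
  have hc := ((key h3).2 (N - 3) le_rfl).2
  refine ⟨fun x hx => hc.differentiableWithinAt_Iio_of_mem_interior (by simpa using hx),
    fun x hx => hc.differentiableWithinAt_Ioi_of_mem_interior (by simpa using hx), ?_, ?_⟩
  · simpa using hc.monotoneOn_leftDeriv
  · simpa using hc.monotoneOn_rightDeriv
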